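/- Let $k$ be a field of characteristic different from $2$ and $3$. Let $L$ be a Mal'tsev algebra over $k$, that is, a $k$-vector space with a bilinear bracket such that $[x,x]=0$ and $[J(x,y,z),x]=J(x,y,[x,z])$ for all $x,y,z\in L$, where $J(x,y,z)=[x,[y,z]]+[y,[z,x]]+[z,[x,y]]$. Let $U(L)$ be the quotient of the free unital nonassociative $k$-algebra on the vector space $L$ by the two-sided ideal generated by $xy-yx-[x,y]$, $(x,h,g)+(h,x,g)$ and $(h,x,g)+(h,g,x)$, for $x,y\in L$ and $h,g$ in the free algebra, where $(a,b,c)=(ab)c-a(bc)$. A Hopf quasigroup is a unital, possibly nonassociative $k$-algebra $H$ with unital algebra homomorphisms $\Delta:H\to H\otimes H$ and $\varepsilon:H\to k$ forming a coassociative counital coalgebra, and a linear map $S:H\to H$ such that, writing $\Delta h=h_{(1)}\otimes h_{(2)}$, $$S(h_{(1)})(h_{(2)}g)=\varepsilon(h)g=h_{(1)}(S(h_{(2)})g),\qquad (hS(g_{(1)}))g_{(2)}=h\,\varepsilon(g)=(hg_{(1)})S(g_{(2)})\qquad\text{for all } h,g\in H.$$ **Proposition 4.8.** There is a unique Hopf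 quasigroup structure $(\Delta,\varepsilon,S)$ on the algebra $U(L)$ such that $\Delta x=x\otimes 1+1\otimes x$, $\varepsilon x=0$ and $Sx=-x$ for all $x$ in (the image of) $L$, and such that $S$ is a unital anti-algebra homomorphism, i.e. $S(1)=1$ and $S(uv)=S(v)S(u)$ for all $u,v\in U(L)$. -/

import Mathlib

open scoped TensorProduct

/-- `b` makes `L` a Mal'tsev algebra: `b` is alternating and, with the Jacobian
`J(x,y,z) = [x,[y,z]] + [y,[z,x]] + [z,[x,y]]`, one has `[J(x,y,z),x] = J(x,y,[x,z])`. -/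
structure IsMaltsevBracket {k L : Type*} [CommRing k] [AddCommGroup L] [Module k L]
    (b : L →ₗ[k] L →ₗ[k] L) : Prop where
  self : ∀ x, b x x = 0
  maltsev : ∀ x y z,
    b (b x (b y z) + b y (b z x) + b z (b x y)) x =
      b x (b y (b x z)) + b y (b (b x z) x) + b (b x z) (b x y)

/-- The free unital nonassociative `k`-algebra on the set `X`: its basis is `1` together with all
bracketed words in `X`. -/
abbrev FreeUnitalNonassocAlgebra (k X : Type*) [CommRing k] : Type _ :=
  MonoidAlgebra k (WithOne (FreeMagma X))

/-- The inclusion of the generators in the free unital nonassociative algebra. -/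
noncomputable def FreeUnitalNonassocAlgebra.of (k : Type*) {X : Type*} [CommRing k] (x : X) :
    FreeUnitalNonassocAlgebra k X :=
  MonoidAlgebra.single ((FreeMagma.of x : FreeMagma X) : WithOne (FreeMagma X)) 1

namespace MaltsevEnveloping

open FreeUnitalNonassocAlgebra (of)

/-- The defining relations of the enveloping algebra. The relations `add` and `smul` pass from the
free algebra on the set `L` to the free algebra on the module `L` (that is, on a basis of `L`). -/
inductive Rel {k L : Type*} [CommRing k] [AddCommGroup L] [Module k L] (b : L →ₗ[k] L →ₗ[k] L) :
    FreeUnitalNonassocAlgebra k L → FreeUnitalNonassocAlgebra k L → Prop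
  | add (x y : L) : Rel b (of k (x + y)) (of k x + of k y)
  | smul (c : k) (x : L) : Rel b (of k (c • x)) (c • of k x)
  | commutator (x y : L) : Rel b (of k x * of k y - of k y * of k x) (of k (b x y))
  | left_alternating (x : L) (h g : FreeUnitalNonassocAlgebra k L) :
      Rel b (associator (of k x) h g + associator h (of k x) g) 0
  | right_alternating (x : L) (h g : FreeUnitalNonassocAlgebra k L) :
      Rel b (associator h (of k x) g + associator h g (of k x)) 0

end MaltsevEnveloping

/-- The enveloping algebra `U(L)`: the quotient of the free unital nonassociative algebra by the
two-sided ideal (here: the ring congruence) generated by the defining relations. -/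
abbrev MaltsevEnveloping {k L : Type*} [CommRing k] [AddCommGroup L] [Module k L]
    (b : L →ₗ[k] L →ₗ[k] L) : Type _ :=
  (ringConGen (MaltsevEnveloping.Rel b)).Quotient

noncomputable instance {k L : Type*} [CommRing k] [AddCommGroup L] [Module k L]
    (b : L →ₗ[k] L →ₗ[k] L) : Module k (MaltsevEnveloping b) where
  add_smul r s := Quotient.ind fun a => congrArg Quotient.mk'' (add_smul r s a)
  zero_smul := Quotient.ind fun a => congrArg Quotient.mk'' (zero_smul k a)

/-- The canonical map `L → U(L)`. -/
noncomputable def MaltsevEnveloping.ι {k L : Type*} [CommRing k] [AddCommGroup L] [Module k L]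
    (b : L →ₗ[k] L →ₗ[k] L) (x : L) : MaltsevEnveloping b :=
  (FreeUnitalNonassocAlgebra.of k x : FreeUnitalNonassocAlgebra k L)

/-- A Hopf quasigroup structure on a unital, not necessarily associative, `k`-algebra `H`: a
(coassociative, counital) coalgebra structure whose coproduct and counit are unital algebra
homomorphisms, with a linear map `S` satisfying, in Sweedler notation,
`S(h₁)(h₂ g) = ε(h) g = h₁(S(h₂) g)` and `(h S(g₁)) g₂ = h ε(g) = (h g₁) S(g₂)`. -/
class HopfQuasigroup (k H : Type*) [CommRing k] [NonAssocRing H] [Module k H]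
    [IsScalarTower k H H] [SMulCommClass k H H] extends Coalgebra k H where
  comul_one : comul (1 : H) = 1
  comul_mul : ∀ a b : H, comul (a * b) = comul a * comul b
  counit_one : counit (1 : H) = 1
  counit_mul : ∀ a b : H, counit (a * b) = counit a * counit b
  antipode : H →ₗ[k] H
  antipode_mul_left :
    LinearMap.mul' k H ∘ₗ (LinearMap.mul' k H).lTensor H ∘ₗ
      (TensorProduct.assoc k H H H).toLinearMap ∘ₗ
      (antipode.rTensor H).rTensor H ∘ₗ comul.rTensor H =
    (TensorProduct.lid k H).toLinearMap ∘ₗ counit.rTensor H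
  mul_antipode_left :
    LinearMap.mul' k H ∘ₗ (LinearMap.mul' k H).lTensor H ∘ₗ
      (TensorProduct.assoc k H H H).toLinearMap ∘ₗ
      (antipode.lTensor H).rTensor H ∘ₗ comul.rTensor H =
    (TensorProduct.lid k H).toLinearMap ∘ₗ counit.rTensor H
  antipode_mul_right :
    LinearMap.mul' k H ∘ₗ (LinearMap.mul' k H).rTensor H ∘ₗ
      (TensorProduct.assoc k H H H).symm.toLinearMap ∘ₗ
      (antipode.rTensor H).lTensor H ∘ₗ comul.lTensor H =
    (TensorProduct.rid k H).toLinearMap ∘ₗ counit.lTensor H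
  mul_antipode_right :
    LinearMap.mul' k H ∘ₗ (LinearMap.mul' k H).rTensor H ∘ₗ
      (TensorProduct.assoc k H H H).symm.toLinearMap ∘ₗ
      (antipode.lTensor H).lTensor H ∘ₗ comul.lTensor H =
    (TensorProduct.rid k H).toLinearMap ∘ₗ counit.lTensor H

/-!
An element `a` of `L` is alternating in `U(L)`, so that `L_{au} = (L_a + R_a) L_u - L_u R_a` and
`L_{ua} = L_u (L_a + R_a) - R_a L_u` in the algebra of endomorphisms of `U(L)`. These identities
have two consequences.

* Every `L_u` lies in the associative algebra generated by the `L_a` and `R_a` with `a` in `L`.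
  Applying `L_u` to `1` shows that a subspace which contains `1` and is stable under multiplication
  by `L` on both sides is everything.
* Let `T u = L_{S(u₁)} L_{u₂}`, so that the first antipode identity reads `T u = ε(u)`. As `a` is
  primitive and `S` is an anti-homomorphism with `S a = -a`, both `T (au)` and `T (ua)` are
  commutators of `T u` with an endomorphism depending only on `a`. They vanish when `T u` is a
  scalar, so the subspace of all `u` with `T u = ε(u)` is stable under multiplication by `L`.

The other antipode identities follow in the same way from right multiplications in the opposite
algebra and from exchanging the two tensor factors.
-/

/-- `a` is an alternating element: associators change sign when `a` is moved to an adjacent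
argument. -/
structure IsAlternating {A : Type*} [NonAssocRing A] (a : A) : Prop where
  left : ∀ u v : A, associator a u v + associator u a v = 0
  right : ∀ u v : A, associator u a v + associator u v a = 0

namespace IsAlternating

section NonAssocRing

variable {A : Type*} [NonAssocRing A] {a b : A}

theorem mul_mul_eq_left (ha : IsAlternating a) (u v : A) :
    (a * u) * v = a * (u * v) + (u * v) * a - u * (v * a) := by
  have h₁ := ha.left u v
  have h₂ := ha.right u v
  simp only [associator_apply] at h₁ h₂
  linear_combination (norm := abel) h₁ - h₂

theorem mul_mul_eq_middle (ha : IsAlternating a) (u v : A) :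
    (u * a) * v = u * (a * v) + u * (v * a) - (u * v) * a := by
  have h := ha.right u v
  simp only [associator_apply] at h
  linear_combination (norm := abel) h

theorem mul_mul_eq_middle' (ha : IsAlternating a) (u v : A) :
    v * (a * u) = (v * a) * u + (a * v) * u - a * (v * u) := by
  have h := ha.left v u
  simp only [associator_apply] at h
  linear_combination (norm := abel) -h

theorem mul_mul_eq_right (ha : IsAlternating a) (u v : A) :
    v * (u * a) = (v * u) * a + a * (v * u) - (a * v) * u := by
  have h₁ := ha.left v u
  have h₂ := ha.right v u
  simp only [associator_apply] at h₁ h₂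
  linear_combination (norm := abel) h₁ - h₂

theorem add (ha : IsAlternating a) (hb : IsAlternating b) : IsAlternating (a + b) where
  left u v := by
    have h₁ := ha.left u v
    have h₂ := hb.left u v
    simp only [← AddMonoidHom.associator_apply, map_add, AddMonoidHom.add_apply] at h₁ h₂ ⊢
    rw [add_add_add_comm, h₁, h₂, add_zero]
  right u v := by
    have h₁ := ha.right u v
    have h₂ := hb.right u v
    simp only [← AddMonoidHom.associator_apply, map_add, AddMonoidHom.add_apply] at h₁ h₂ ⊢
    rw [add_add_add_comm, h₁, h₂, add_zero]

theorem neg (ha : IsAlternating a) : IsAlternating (-a) where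
  left u v := by
    have h := ha.left u v
    simp only [← AddMonoidHom.associator_apply, map_neg, AddMonoidHom.neg_apply] at h ⊢
    rw [← neg_add, h, neg_zero]
  right u v := by
    have h := ha.right u v
    simp only [← AddMonoidHom.associator_apply, map_neg, AddMonoidHom.neg_apply] at h ⊢
    rw [← neg_add, h, neg_zero]

theorem op (ha : IsAlternating a) : IsAlternating (MulOpposite.op a) where
  left u v := by
    rw [associator_op, associator_op, ← neg_add, ← MulOpposite.op_add, MulOpposite.unop_op,
      add_comm, ha.right, MulOpposite.op_zero, neg_zero]
  right u v := by
    rw [associator_op, associator_op, ← neg_add, ← MulOpposite.op_add, MulOpposite.unop_op,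
      add_comm, ha.left, MulOpposite.op_zero, neg_zero]

theorem of_comm_assoc {R : Type*} [CommRing R] (a : R) : IsAlternating a where
  left u v := by simp only [associator_eq_zero, Pi.zero_apply, add_zero]
  right u v := by simp only [associator_eq_zero, Pi.zero_apply, add_zero]

end NonAssocRing

section TensorProduct

variable {k A B : Type*} [CommRing k]
  [NonAssocRing A] [Module k A] [IsScalarTower k A A] [SMulCommClass k A A]
  [NonAssocRing B] [Module k B] [IsScalarTower k B B] [SMulCommClass k B B]

theorem of_tmul {t : A ⊗[k] B}
    (left : ∀ a b a' b', associator t (a ⊗ₜ b) (a' ⊗ₜ b') + associator (a ⊗ₜ b) t (a' ⊗ₜ b') = 0)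
    (right : ∀ a b a' b',
      associator (a ⊗ₜ b) t (a' ⊗ₜ b') + associator (a ⊗ₜ b) (a' ⊗ₜ b') t = 0) :
    IsAlternating t := by
  simp only [← AddMonoidHom.associator_apply] at left right
  constructor <;> intro u v <;> simp only [← AddMonoidHom.associator_apply] <;>
    induction u with
    | zero => simp only [map_zero, AddMonoidHom.zero_apply, add_zero]
    | add u u' hu hu' =>
      simp only [map_add, AddMonoidHom.add_apply]
      rw [add_add_add_comm, hu, hu', add_zero]
    | tmul a b =>
      induction v with
      | zero => simp only [map_zero, AddMonoidHom.zero_apply, add_zero]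
      | add v v' hv hv' =>
        simp only [map_add, AddMonoidHom.add_apply]
        rw [add_add_add_comm, hv, hv', add_zero]
      | tmul a' b' => first | exact left a b a' b' | exact right a b a' b'

theorem tmul_one {x : A} (hx : IsAlternating x) : IsAlternating (x ⊗ₜ[k] (1 : B)) := by
  refine of_tmul (fun a b a' b' => ?_) fun a b a' b' => ?_
  · simpa only [associator_apply, Algebra.TensorProduct.tmul_mul_tmul, one_mul, mul_one,
      TensorProduct.add_tmul, TensorProduct.sub_tmul, TensorProduct.zero_tmul] using
      congrArg (· ⊗ₜ[k] (b * b')) (hx.left a a')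
  · simpa only [associator_apply, Algebra.TensorProduct.tmul_mul_tmul, one_mul, mul_one,
      TensorProduct.add_tmul, TensorProduct.sub_tmul, TensorProduct.zero_tmul] using
      congrArg (· ⊗ₜ[k] (b * b')) (hx.right a a')

theorem one_tmul {x : B} (hx : IsAlternating x) : IsAlternating ((1 : A) ⊗ₜ[k] x) := by
  refine of_tmul (fun a b a' b' => ?_) fun a b a' b' => ?_
  · simpa only [associator_apply, Algebra.TensorProduct.tmul_mul_tmul, one_mul, mul_one,
      TensorProduct.tmul_add, TensorProduct.tmul_sub, TensorProduct.tmul_zero] using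
      congrArg ((a * a') ⊗ₜ[k] ·) (hx.left b b')
  · simpa only [associator_apply, Algebra.TensorProduct.tmul_mul_tmul, one_mul, mul_one,
      TensorProduct.tmul_add, TensorProduct.tmul_sub, TensorProduct.tmul_zero] using
      congrArg ((a * a') ⊗ₜ[k] ·) (hx.right b b')

end TensorProduct

end IsAlternating

section MultiplicationAlgebra

variable {k A : Type*} [CommRing k] [NonAssocRing A] [Module k A] [IsScalarTower k A A]
  [SMulCommClass k A A] {X : Set A}

variable (k X) in
/-- The multiplication algebra of `X`: the associative algebra of endomorphisms of `A` generated by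
the left and right multiplications by elements of `X`. -/
def multiplicationAlgebra : Subalgebra k (Module.End k A) :=
  Algebra.adjoin k (LinearMap.mulLeft k '' X ∪ LinearMap.mulRight k '' X)

theorem mulLeft_mem_multiplicationAlgebra {x : A} (hx : x ∈ X) :
    LinearMap.mulLeft k x ∈ multiplicationAlgebra k X :=
  Algebra.subset_adjoin (.inl ⟨x, hx, rfl⟩)

theorem mulRight_mem_multiplicationAlgebra {x : A} (hx : x ∈ X) :
    LinearMap.mulRight k x ∈ multiplicationAlgebra k X :=
  Algebra.subset_adjoin (.inr ⟨x, hx, rfl⟩)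

theorem IsAlternating.mulLeft_mul {a : A} (ha : IsAlternating a) (u : A) :
    LinearMap.mulLeft k (a * u) =
      (LinearMap.mulLeft k a + LinearMap.mulRight k a) * LinearMap.mulLeft k u -
        LinearMap.mulLeft k u * LinearMap.mulRight k a :=
  LinearMap.ext fun v => ha.mul_mul_eq_left u v

theorem IsAlternating.mulLeft_mul' {a : A} (ha : IsAlternating a) (u : A) :
    LinearMap.mulLeft k (u * a) =
      LinearMap.mulLeft k u * (LinearMap.mulLeft k a + LinearMap.mulRight k a) -
        LinearMap.mulRight k a * LinearMap.mulLeft k u :=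
  LinearMap.ext fun v => (ha.mul_mul_eq_middle u v).trans <| by
    simp only [LinearMap.sub_apply, Module.End.mul_apply, LinearMap.add_apply,
      LinearMap.mulLeft_apply, LinearMap.mulRight_apply, mul_add]

theorem mulLeft_apply_mem_multiplicationAlgebra (hX : ∀ x ∈ X, IsAlternating x)
    {f : Module.End k A} (hf : f ∈ multiplicationAlgebra k X) :
    ∀ u, LinearMap.mulLeft k u ∈ multiplicationAlgebra k X →
      LinearMap.mulLeft k (f u) ∈ multiplicationAlgebra k X := by
  induction hf using Algebra.adjoin_induction with
  | mem _ hf =>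
    intro u hu
    rcases hf with ⟨x, hx, rfl⟩ | ⟨x, hx, rfl⟩
    · rw [LinearMap.mulLeft_apply, (hX x hx).mulLeft_mul]
      exact sub_mem (mul_mem (add_mem (mulLeft_mem_multiplicationAlgebra hx)
        (mulRight_mem_multiplicationAlgebra hx)) hu)
        (mul_mem hu (mulRight_mem_multiplicationAlgebra hx))
    · rw [LinearMap.mulRight_apply, (hX x hx).mulLeft_mul']
      exact sub_mem (mul_mem hu (add_mem (mulLeft_mem_multiplicationAlgebra hx)
        (mulRight_mem_multiplicationAlgebra hx)))
        (mul_mem (mulRight_mem_multiplicationAlgebra hx) hu)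
  | algebraMap c =>
    intro u hu
    have h : LinearMap.mulLeft k (c • u) = c • LinearMap.mulLeft k u :=
      (LinearMap.mul k A).map_smul c u
    rw [Module.algebraMap_end_apply, h]
    exact Subalgebra.smul_mem _ hu c
  | add f g _ _ hf hg =>
    intro u hu
    have h : LinearMap.mulLeft k (f u + g u) =
        LinearMap.mulLeft k (f u) + LinearMap.mulLeft k (g u) :=
      (LinearMap.mul k A).map_add (f u) (g u)
    rw [LinearMap.add_apply, h]
    exact add_mem (hf u hu) (hg u hu)
  | mul _ g _ _ hf hg => exact fun u hu => hf _ (hg u hu)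

theorem mulLeft_mem_multiplicationAlgebra_of_mem_adjoin (hX : ∀ x ∈ X, IsAlternating x) {u : A}
    (hu : u ∈ NonUnitalAlgebra.adjoin k (insert 1 X)) :
    LinearMap.mulLeft k u ∈ multiplicationAlgebra k X := by
  induction hu using NonUnitalAlgebra.adjoin_induction with
  | mem u hu =>
    rcases hu with rfl | hu
    · rw [LinearMap.mulLeft_one]
      exact one_mem (multiplicationAlgebra k X)
    · exact mulLeft_mem_multiplicationAlgebra hu
  | add u v _ _ hu hv =>
    have h := (LinearMap.mul k A).map_add u v
    exact (congrArg (· ∈ multiplicationAlgebra k X) h).mpr (add_mem hu hv)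
  | zero =>
    have h := (LinearMap.mul k A).map_zero
    exact (congrArg (· ∈ multiplicationAlgebra k X) h).mpr (zero_mem (multiplicationAlgebra k X))
  | smul c u _ hu =>
    have h := (LinearMap.mul k A).map_smul c u
    exact (congrArg (· ∈ multiplicationAlgebra k X) h).mpr (Subalgebra.smul_mem _ hu c)
  | mul u v _ _ hu hv => exact mulLeft_apply_mem_multiplicationAlgebra hX hu v hv

theorem map_mem_of_mem_multiplicationAlgebra {p : Submodule k A}
    (left : ∀ x ∈ X, ∀ u ∈ p, x * u ∈ p) (right : ∀ x ∈ X, ∀ u ∈ p, u * x ∈ p)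
    {f : Module.End k A} (hf : f ∈ multiplicationAlgebra k X) : ∀ u ∈ p, f u ∈ p := by
  induction hf using Algebra.adjoin_induction with
  | mem _ hf =>
    rcases hf with ⟨x, hx, rfl⟩ | ⟨x, hx, rfl⟩
    exacts [left x hx, right x hx]
  | algebraMap c => exact fun u hu => p.smul_mem c hu
  | add f g _ _ hf hg => exact fun u hu => p.add_mem (hf u hu) (hg u hu)
  | mul _ g _ _ hf hg => exact fun u hu => hf _ (hg u hu)

theorem adjoin_le_of_mul_mem (hX : ∀ x ∈ X, IsAlternating x) {p : Submodule k A} (one : 1 ∈ p)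
    (left : ∀ x ∈ X, ∀ u ∈ p, x * u ∈ p) (right : ∀ x ∈ X, ∀ u ∈ p, u * x ∈ p) :
    (NonUnitalAlgebra.adjoin k (insert 1 X)).toSubmodule ≤ p := by
  intro u hu
  have h := map_mem_of_mem_multiplicationAlgebra left right
    (mulLeft_mem_multiplicationAlgebra_of_mem_adjoin hX hu) 1 one
  rwa [LinearMap.mulLeft_apply, mul_one] at h

end MultiplicationAlgebra

/-- `f` is a homomorphism of unital, not necessarily associative, algebras. Mathlib's `AlgHom` is
not available for nonassociative algebras, and `NonUnitalAlgHom` does not preserve `1`. -/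
structure IsUnitalAlgHom {k A B : Type*} [CommSemiring k] [NonAssocSemiring A] [Module k A]
    [NonAssocSemiring B] [Module k B] (f : A →ₗ[k] B) : Prop where
  map_one : f 1 = 1
  map_mul : ∀ u v, f (u * v) = f u * f v

namespace IsUnitalAlgHom

variable {k A B C D : Type*} [CommSemiring k] [NonAssocSemiring A] [Module k A]
  [NonAssocSemiring B] [Module k B] [NonAssocSemiring C] [Module k C]
  [NonAssocSemiring D] [Module k D]

theorem id : IsUnitalAlgHom (LinearMap.id : A →ₗ[k] A) where
  map_one := rfl
  map_mul _ _ := rfl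

theorem comp {g : B →ₗ[k] C} {f : A →ₗ[k] B} (hg : IsUnitalAlgHom g) (hf : IsUnitalAlgHom f) :
    IsUnitalAlgHom (g ∘ₗ f) where
  map_one := (congrArg g hf.map_one).trans hg.map_one
  map_mul u v := (congrArg g (hf.map_mul u v)).trans (hg.map_mul _ _)

variable [IsScalarTower k A A] [SMulCommClass k A A]

theorem ext_of_adjoin_eq_top {X : Set A} (hX : NonUnitalAlgebra.adjoin k (insert 1 X) = ⊤)
    {f g : A →ₗ[k] B} (hf : IsUnitalAlgHom f) (hg : IsUnitalAlgHom g)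
    (h : ∀ x ∈ X, f x = g x) : f = g := by
  refine LinearMap.ext fun u => ?_
  have hu : u ∈ NonUnitalAlgebra.adjoin k (insert 1 X) := hX ▸ trivial
  induction hu using NonUnitalAlgebra.adjoin_induction with
  | mem x hx =>
    rcases hx with rfl | hx
    · rw [hf.map_one, hg.map_one]
    · exact h x hx
  | zero => rw [f.map_zero, g.map_zero]
  | add u v _ _ hu hv => rw [f.map_add, g.map_add, hu, hv]
  | smul c u _ hu => rw [f.map_smul, g.map_smul, hu]
  | mul u v _ _ hu hv => rw [hf.map_mul, hg.map_mul, hu, hv]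

variable [IsScalarTower k B B] [SMulCommClass k B B]

theorem mk_one_left : IsUnitalAlgHom (TensorProduct.mk k A B 1) where
  map_one := rfl
  map_mul u v := by simp only [TensorProduct.mk_apply, Algebra.TensorProduct.tmul_mul_tmul, one_mul]

theorem mk_one_right : IsUnitalAlgHom ((TensorProduct.mk k A B).flip 1) where
  map_one := rfl
  map_mul u v := by
    simp only [LinearMap.flip_apply, TensorProduct.mk_apply, Algebra.TensorProduct.tmul_mul_tmul,
      one_mul]

variable [IsScalarTower k C C] [SMulCommClass k C C] [IsScalarTower k D D] [SMulCommClass k D D]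

theorem map {f : A →ₗ[k] C} {g : B →ₗ[k] D} (hf : IsUnitalAlgHom f) (hg : IsUnitalAlgHom g) :
    IsUnitalAlgHom (TensorProduct.map f g) where
  map_one := congrArg₂ (· ⊗ₜ[k] ·) hf.map_one hg.map_one
  map_mul := by
    have h : (LinearMap.mul k (A ⊗[k] B)).compr₂ (TensorProduct.map f g) =
        (LinearMap.mul k (C ⊗[k] D)).compl₁₂ (TensorProduct.map f g) (TensorProduct.map f g) := by
      ext a b a' b'
      simp [hf.map_mul, hg.map_mul]
    exact LinearMap.congr_fun₂ h

theorem tensorProduct_assoc :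
    IsUnitalAlgHom (TensorProduct.assoc k A B C).toLinearMap where
  map_one := rfl
  map_mul := by
    let e := (TensorProduct.assoc k A B C).toLinearMap
    have h : (LinearMap.mul k ((A ⊗[k] B) ⊗[k] C)).compr₂ e =
        (LinearMap.mul k (A ⊗[k] (B ⊗[k] C))).compl₁₂ e e := by
      ext a b c a' b' c'
      simp [e]
    exact LinearMap.congr_fun₂ h

end IsUnitalAlgHom

/-- `P` twists multiplication by `a` into a commutator with `c` and `d`, in such a way that
`u ↦ L_u` has this property for every alternating `a`, with `c = L_a + R_a` and `d = R_a`. -/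
structure HasTwist {k A B : Type*} [CommRing k] [NonAssocRing A] [Module k A] [Ring B] [Module k B]
    (P : A →ₗ[k] B) (a : A) (c d : B) : Prop where
  map_mul_left : ∀ u, P (a * u) = c * P u - P u * d
  map_mul_right : ∀ u, P (u * a) = P u * c - d * P u

theorem HasTwist.comp_of_anti {k A B : Type*} [CommRing k] [NonAssocRing A] [Module k A]
    [Ring B] [Module k B] {P : A →ₗ[k] B} {a : A} {c d : B} (hP : HasTwist P a c d)
    {S : A →ₗ[k] A}
    (hS : ∀ u v, S (u * v) = S v * S u) (ha : S a = -a) : HasTwist (P ∘ₗ S) a d c where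
  map_mul_left u := by
    rw [LinearMap.comp_apply, hS, ha, mul_neg, map_neg, hP.map_mul_right, neg_sub]
    rfl
  map_mul_right u := by
    rw [LinearMap.comp_apply, hS, ha, neg_mul, map_neg, hP.map_mul_left, neg_sub]
    rfl

section Twist

variable {k A B : Type*} [CommRing k] [NonAssocRing A] [Module k A] [IsScalarTower k A A]
  [SMulCommClass k A A]

variable (k A) in
/-- Right multiplication `u ↦ R_u`, as a map into the opposite of the endomorphism algebra, so that
it is multiplicative when `A` is associative. -/
def rightMul : A →ₗ[k] (Module.End k A)ᵐᵒᵖ :=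
  (MulOpposite.opLinearEquiv k).toLinearMap ∘ₗ (LinearMap.mul k A).flip

theorem linearMap_mul_one : LinearMap.mul k A 1 = 1 :=
  LinearMap.mulLeft_one k A

theorem rightMul_apply (u : A) : rightMul k A u = MulOpposite.op (LinearMap.mulRight k u) := rfl

theorem rightMul_one : rightMul k A 1 = 1 :=
  congrArg MulOpposite.op (LinearMap.mulRight_one k A)

theorem IsAlternating.hasTwist_mul {a : A} (ha : IsAlternating a) :
    HasTwist (LinearMap.mul k A) a (LinearMap.mulLeft k a + LinearMap.mulRight k a)
      (LinearMap.mulRight k a) where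
  map_mul_left := ha.mulLeft_mul
  map_mul_right := ha.mulLeft_mul'

theorem IsAlternating.hasTwist_rightMul {a : A} (ha : IsAlternating a) :
    HasTwist (rightMul k A) a (MulOpposite.op (LinearMap.mulLeft k a + LinearMap.mulRight k a))
      (MulOpposite.op (LinearMap.mulLeft k a)) where
  map_mul_left u := MulOpposite.unop_injective <| LinearMap.ext fun v =>
    (ha.mul_mul_eq_middle' u v).trans <| by
      simp [rightMul_apply, mul_add, add_comm]
  map_mul_right u := MulOpposite.unop_injective <| LinearMap.ext fun v =>
    (ha.mul_mul_eq_right u v).trans <| by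
      simp [rightMul_apply, add_mul, add_comm]

variable [Ring B] [Algebra k B] {P Q : A →ₗ[k] B} {a : A} {c d : B}

theorem HasTwist.mul'_map_primitive_mul (hP : HasTwist P a c d) (hQ : HasTwist Q a d c)
    (t : A ⊗[k] A) :
    LinearMap.mul' k B (TensorProduct.map P Q ((a ⊗ₜ 1 + 1 ⊗ₜ a) * t)) =
      c * LinearMap.mul' k B (TensorProduct.map P Q t) -
        LinearMap.mul' k B (TensorProduct.map P Q t) * c := by
  induction t with
  | zero => simp only [mul_zero, map_zero, zero_mul, sub_zero]
  | add s t hs ht =>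
    rw [mul_add, map_add, map_add, hs, ht]
    simp only [map_add, mul_add, add_mul]
    abel
  | tmul u v =>
    simp only [add_mul, Algebra.TensorProduct.tmul_mul_tmul, one_mul, map_add,
      TensorProduct.map_tmul, LinearMap.mul'_apply, hP.map_mul_left, hQ.map_mul_left]
    noncomm_ring

theorem HasTwist.mul'_map_mul_primitive (hP : HasTwist P a c d) (hQ : HasTwist Q a d c)
    (t : A ⊗[k] A) :
    LinearMap.mul' k B (TensorProduct.map P Q (t * (a ⊗ₜ 1 + 1 ⊗ₜ a))) =
      LinearMap.mul' k B (TensorProduct.map P Q t) * d -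
        d * LinearMap.mul' k B (TensorProduct.map P Q t) := by
  induction t with
  | zero => simp only [mul_zero, map_zero, zero_mul, sub_zero]
  | add s t hs ht =>
    rw [add_mul, map_add, map_add, hs, ht]
    simp only [map_add, mul_add, add_mul]
    abel
  | tmul u v =>
    simp only [mul_add, Algebra.TensorProduct.tmul_mul_tmul, mul_one, map_add,
      TensorProduct.map_tmul, LinearMap.mul'_apply, hP.map_mul_right, hQ.map_mul_right]
    noncomm_ring

end Twist

section PrimitivelyGenerated

variable {k A : Type*} [CommRing k] [NonAssocRing A] [Module k A] [IsScalarTower k A A]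
  [SMulCommClass k A A] {Δ : A →ₗ[k] A ⊗[k] A} {ε : A →ₗ[k] k} {X : Set A}

theorem coassoc_of_primitive (hX : NonUnitalAlgebra.adjoin k (insert 1 X) = ⊤)
    (hΔ : IsUnitalAlgHom Δ) (hΔX : ∀ x ∈ X, Δ x = x ⊗ₜ 1 + 1 ⊗ₜ x) :
    (TensorProduct.assoc k A A A).toLinearMap ∘ₗ Δ.rTensor A ∘ₗ Δ = Δ.lTensor A ∘ₗ Δ := by
  refine (IsUnitalAlgHom.tensorProduct_assoc.comp <| (hΔ.map .id).comp hΔ).ext_of_adjoin_eq_top hX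
    ((IsUnitalAlgHom.id.map hΔ).comp hΔ) fun x hx => ?_
  simp [hΔX x hx, hΔ.map_one, Algebra.TensorProduct.one_def, TensorProduct.add_tmul,
    TensorProduct.tmul_add, add_assoc]

theorem rTensor_counit_comp_comul_of_primitive (hX : NonUnitalAlgebra.adjoin k (insert 1 X) = ⊤)
    (hΔ : IsUnitalAlgHom Δ) (hΔX : ∀ x ∈ X, Δ x = x ⊗ₜ 1 + 1 ⊗ₜ x) (hε : IsUnitalAlgHom ε)
    (hεX : ∀ x ∈ X, ε x = 0) : ε.rTensor A ∘ₗ Δ = TensorProduct.mk k k A 1 := by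
  refine ((hε.map .id).comp hΔ).ext_of_adjoin_eq_top hX .mk_one_left fun x hx => ?_
  simp [hΔX x hx, hεX x hx, hε.map_one]

theorem lTensor_counit_comp_comul_of_primitive (hX : NonUnitalAlgebra.adjoin k (insert 1 X) = ⊤)
    (hΔ : IsUnitalAlgHom Δ) (hΔX : ∀ x ∈ X, Δ x = x ⊗ₜ 1 + 1 ⊗ₜ x) (hε : IsUnitalAlgHom ε)
    (hεX : ∀ x ∈ X, ε x = 0) : ε.lTensor A ∘ₗ Δ = (TensorProduct.mk k A k).flip 1 := by
  refine ((IsUnitalAlgHom.id.map hε).comp hΔ).ext_of_adjoin_eq_top hX .mk_one_right fun x hx => ?_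
  simp [hΔX x hx, hεX x hx, hε.map_one]

theorem mul'_comp_map_comp_comul_of_hasTwist {B : Type*} [Ring B] [Algebra k B]
    (hX : NonUnitalAlgebra.adjoin k (insert 1 X) = ⊤) (hXA : ∀ x ∈ X, IsAlternating x)
    (hΔ : IsUnitalAlgHom Δ) (hΔX : ∀ x ∈ X, Δ x = x ⊗ₜ 1 + 1 ⊗ₜ x) (hε : IsUnitalAlgHom ε)
    (hεX : ∀ x ∈ X, ε x = 0) {P Q : A →ₗ[k] B} (hP : P 1 = 1) (hQ : Q 1 = 1)
    (hPQ : ∀ x ∈ X, ∃ c d, HasTwist P x c d ∧ HasTwist Q x d c) :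
    LinearMap.mul' k B ∘ₗ TensorProduct.map P Q ∘ₗ Δ = Algebra.linearMap k B ∘ₗ ε := by
  let p : Submodule k A := LinearMap.eqLocus
    (LinearMap.mul' k B ∘ₗ TensorProduct.map P Q ∘ₗ Δ) (Algebra.linearMap k B ∘ₗ ε)
  have mem_p {u : A} : u ∈ p ↔
      LinearMap.mul' k B (TensorProduct.map P Q (Δ u)) = algebraMap k B (ε u) := Iff.rfl
  have hp : (⊤ : NonUnitalSubalgebra k A).toSubmodule ≤ p := by
    rw [← hX]
    refine adjoin_le_of_mul_mem hXA ?_ (fun x hx u hu => ?_) fun x hx u hu => ?_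
    · rw [mem_p, hΔ.map_one, Algebra.TensorProduct.one_def, TensorProduct.map_tmul, hP, hQ,
        LinearMap.mul'_apply, mul_one, hε.map_one, map_one]
    · obtain ⟨c, d, hPx, hQx⟩ := hPQ x hx
      rw [mem_p] at hu ⊢
      rw [hΔ.map_mul, hΔX x hx, hPx.mul'_map_primitive_mul hQx, hu, ← Algebra.commutes, sub_self,
        hε.map_mul, hεX x hx, zero_mul, map_zero]
    · obtain ⟨c, d, hPx, hQx⟩ := hPQ x hx
      rw [mem_p] at hu ⊢
      rw [hΔ.map_mul, hΔX x hx, hPx.mul'_map_mul_primitive hQx, hu, Algebra.commutes, sub_self,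
        hε.map_mul, hεX x hx, mul_zero, map_zero]
  exact LinearMap.ext fun u => hp (Submodule.mem_top (x := u))

end PrimitivelyGenerated

section ConvolutionInverse

variable {k A : Type*} [CommRing k] [NonAssocRing A] [Module k A] [IsScalarTower k A A]
  [SMulCommClass k A A] {Δ : A →ₗ[k] A ⊗[k] A} {ε : A →ₗ[k] k} {f g : A →ₗ[k] A}

theorem mul'_comp_lTensor_comp_assoc_comp_rTensor
    (h : LinearMap.mul' k (Module.End k A) ∘ₗ
      TensorProduct.map (LinearMap.mul k A ∘ₗ f) (LinearMap.mul k A ∘ₗ g) ∘ₗ Δ =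
        Algebra.linearMap k (Module.End k A) ∘ₗ ε) :
    LinearMap.mul' k A ∘ₗ (LinearMap.mul' k A).lTensor A ∘ₗ
      (TensorProduct.assoc k A A A).toLinearMap ∘ₗ
      (TensorProduct.map f g).rTensor A ∘ₗ Δ.rTensor A =
    (TensorProduct.lid k A).toLinearMap ∘ₗ ε.rTensor A := by
  have act (t : A ⊗[k] A) (v : A) :
      LinearMap.mul' k A ((LinearMap.mul' k A).lTensor A (TensorProduct.assoc k A A A
        (TensorProduct.map f g t ⊗ₜ v))) =
      LinearMap.mul' k (Module.End k A)
        (TensorProduct.map (LinearMap.mul k A ∘ₗ f) (LinearMap.mul k A ∘ₗ g) t) v := by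
    induction t with
    | zero => simp
    | add s t hs ht => simp only [map_add, TensorProduct.add_tmul, LinearMap.add_apply, hs, ht]
    | tmul a b => simp
  refine TensorProduct.ext' fun u v => (act (Δ u) v).trans ?_
  exact congrArg (· v) (LinearMap.congr_fun h u)

theorem mul'_comp_rTensor_comp_assoc_symm_comp_lTensor
    (h : LinearMap.mul' k (Module.End k A)ᵐᵒᵖ ∘ₗ
      TensorProduct.map (rightMul k A ∘ₗ f) (rightMul k A ∘ₗ g) ∘ₗ Δ =
        Algebra.linearMap k (Module.End k A)ᵐᵒᵖ ∘ₗ ε) :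
    LinearMap.mul' k A ∘ₗ (LinearMap.mul' k A).rTensor A ∘ₗ
      (TensorProduct.assoc k A A A).symm.toLinearMap ∘ₗ
      (TensorProduct.map f g).lTensor A ∘ₗ Δ.lTensor A =
    (TensorProduct.rid k A).toLinearMap ∘ₗ ε.lTensor A := by
  have act (t : A ⊗[k] A) (v : A) :
      LinearMap.mul' k A ((LinearMap.mul' k A).rTensor A ((TensorProduct.assoc k A A A).symm
        (v ⊗ₜ TensorProduct.map f g t))) =
      (LinearMap.mul' k (Module.End k A)ᵐᵒᵖ
        (TensorProduct.map (rightMul k A ∘ₗ f) (rightMul k A ∘ₗ g) t)).unop v := by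
    induction t with
    | zero => simp
    | add s t hs ht =>
      simp only [map_add, TensorProduct.tmul_add, MulOpposite.unop_add, LinearMap.add_apply, hs, ht]
    | tmul a b => simp [rightMul_apply]
  refine TensorProduct.ext' fun v u => (act (Δ u) v).trans ?_
  exact congrArg (fun T => T.unop v) (LinearMap.congr_fun h u)

end ConvolutionInverse

namespace HopfQuasigroup

variable {k A : Type*} [CommRing k] [NonAssocRing A] [Module k A] [IsScalarTower k A A]
  [SMulCommClass k A A]

/-- The Hopf quasigroup structure on an algebra generated by alternating elements, given a coproduct
and a counit for which these are primitive, and an anti-homomorphism that negates them. -/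
noncomputable abbrev ofPrimitive {X : Set A} (hX : NonUnitalAlgebra.adjoin k (insert 1 X) = ⊤)
    (hXA : ∀ x ∈ X, IsAlternating x)
    (Δ : A →ₗ[k] A ⊗[k] A) (hΔ : IsUnitalAlgHom Δ) (hΔX : ∀ x ∈ X, Δ x = x ⊗ₜ 1 + 1 ⊗ₜ x)
    (ε : A →ₗ[k] k) (hε : IsUnitalAlgHom ε) (hεX : ∀ x ∈ X, ε x = 0)
    (S : A →ₗ[k] A) (hS1 : S 1 = 1) (hS : ∀ u v, S (u * v) = S v * S u)
    (hSX : ∀ x ∈ X, S x = -x) : HopfQuasigroup k A where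
  comul := Δ
  counit := ε
  coassoc := coassoc_of_primitive hX hΔ hΔX
  rTensor_counit_comp_comul := rTensor_counit_comp_comul_of_primitive hX hΔ hΔX hε hεX
  lTensor_counit_comp_comul := lTensor_counit_comp_comul_of_primitive hX hΔ hΔX hε hεX
  comul_one := hΔ.map_one
  comul_mul := hΔ.map_mul
  counit_one := hε.map_one
  counit_mul := hε.map_mul
  antipode := S
  antipode_mul_left := mul'_comp_lTensor_comp_assoc_comp_rTensor <|
    mul'_comp_map_comp_comul_of_hasTwist hX hXA hΔ hΔX hε hεX
      ((congrArg _ hS1).trans linearMap_mul_one) linearMap_mul_one fun x hx =>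
        ⟨_, _, (hXA x hx).hasTwist_mul.comp_of_anti hS (hSX x hx), (hXA x hx).hasTwist_mul⟩
  mul_antipode_left := mul'_comp_lTensor_comp_assoc_comp_rTensor <|
    mul'_comp_map_comp_comul_of_hasTwist hX hXA hΔ hΔX hε hεX
      linearMap_mul_one ((congrArg _ hS1).trans linearMap_mul_one) fun x hx =>
        ⟨_, _, (hXA x hx).hasTwist_mul, (hXA x hx).hasTwist_mul.comp_of_anti hS (hSX x hx)⟩
  antipode_mul_right := mul'_comp_rTensor_comp_assoc_symm_comp_lTensor <|
    mul'_comp_map_comp_comul_of_hasTwist hX hXA hΔ hΔX hε hεX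
      ((congrArg _ hS1).trans rightMul_one) rightMul_one fun x hx =>
        ⟨_, _, (hXA x hx).hasTwist_rightMul.comp_of_anti hS (hSX x hx),
          (hXA x hx).hasTwist_rightMul⟩
  mul_antipode_right := mul'_comp_rTensor_comp_assoc_symm_comp_lTensor <|
    mul'_comp_map_comp_comul_of_hasTwist hX hXA hΔ hΔX hε hεX
      rightMul_one ((congrArg _ hS1).trans rightMul_one) fun x hx =>
        ⟨_, _, (hXA x hx).hasTwist_rightMul,
          (hXA x hx).hasTwist_rightMul.comp_of_anti hS (hSX x hx)⟩

theorem ext_of_eq {Q R : HopfQuasigroup k A} (comul : Q.comul = R.comul)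
    (counit : Q.counit = R.counit) (antipode : Q.antipode = R.antipode) : Q = R := by
  rcases Q with @⟨@⟨@⟨Δ, ε⟩⟩⟩
  rcases R with @⟨@⟨@⟨Δ', ε'⟩⟩⟩
  cases comul
  cases counit
  cases antipode
  rfl

theorem ext_of_adjoin_eq_top {X : Set A} (hX : NonUnitalAlgebra.adjoin k (insert 1 X) = ⊤)
    {Q R : HopfQuasigroup k A}
    (comul : ∀ x ∈ X, Q.comul x = R.comul x) (counit : ∀ x ∈ X, Q.counit x = R.counit x)
    (antipode : ∀ x ∈ X, Q.antipode x = R.antipode x)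
    (Q_one : Q.antipode 1 = 1) (Q_anti : ∀ u v, Q.antipode (u * v) = Q.antipode v * Q.antipode u)
    (R_one : R.antipode 1 = 1) (R_anti : ∀ u v, R.antipode (u * v) = R.antipode v * R.antipode u) :
    Q = R := by
  have hQΔ : IsUnitalAlgHom Q.comul := ⟨Q.comul_one, Q.comul_mul⟩
  have hRΔ : IsUnitalAlgHom R.comul := ⟨R.comul_one, R.comul_mul⟩
  have hQε : IsUnitalAlgHom Q.counit := ⟨Q.counit_one, Q.counit_mul⟩
  have hRε : IsUnitalAlgHom R.counit := ⟨R.counit_one, R.counit_mul⟩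
  let op := MulOpposite.opLinearEquiv (M := A) k
  have hQS : IsUnitalAlgHom (op.toLinearMap ∘ₗ Q.antipode) :=
    ⟨congrArg op Q_one, fun u v => congrArg op (Q_anti u v)⟩
  have hRS : IsUnitalAlgHom (op.toLinearMap ∘ₗ R.antipode) :=
    ⟨congrArg op R_one, fun u v => congrArg op (R_anti u v)⟩
  refine ext_of_eq (hQΔ.ext_of_adjoin_eq_top hX hRΔ comul)
    (hQε.ext_of_adjoin_eq_top hX hRε counit) (LinearMap.ext fun u => op.injective ?_)
  exact LinearMap.congr_fun
    (hQS.ext_of_adjoin_eq_top hX hRS fun x hx => congrArg op (antipode x hx)) u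

end HopfQuasigroup

namespace FreeUnitalNonassocAlgebra

variable {k X : Type*} [CommRing k]

theorem adjoin_insert_one_range_of :
    NonUnitalAlgebra.adjoin k (insert 1 (Set.range (of k : X → FreeUnitalNonassocAlgebra k X))) =
      ⊤ := by
  set s := NonUnitalAlgebra.adjoin k
    (insert 1 (Set.range (of k : X → FreeUnitalNonassocAlgebra k X)))
  have subset : insert 1 (Set.range (of k)) ⊆ (s : Set (FreeUnitalNonassocAlgebra k X)) :=
    NonUnitalAlgebra.subset_adjoin k
  have single (m : WithOne (FreeMagma X)) : MonoidAlgebra.single m (1 : k) ∈ s := by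
    induction m with
    | one => exact subset (.inl rfl)
    | coe m =>
      induction m using FreeMagma.recOnMul with
      | ih1 x => exact subset (.inr ⟨x, rfl⟩)
      | ih2 m n hm hn =>
        rw [WithOne.coe_mul, ← one_mul (1 : k), ← MonoidAlgebra.single_mul_single]
        exact mul_mem hm hn
  refine top_unique fun u _ => ?_
  induction u using MonoidAlgebra.induction_linear with
  | zero => exact zero_mem s
  | add u v hu hv => exact add_mem (hu trivial) (hv trivial)
  | single m c =>
    rw [← mul_one c, ← smul_eq_mul, ← MonoidAlgebra.smul_single]
    exact SMulMemClass.smul_mem c (single m)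

variable {B : Type*} [NonAssocRing B] [Module k B] [IsScalarTower k B B] [SMulCommClass k B B]

variable (k) in
/-- The unital homomorphism from the free algebra determined by the images of the generators. -/
noncomputable def lift (f : X → B) : FreeUnitalNonassocAlgebra k X →ₙₐ[k] B :=
  MonoidAlgebra.liftMagma k (WithOne.lift (FreeMagma.lift f) : WithOne (FreeMagma X) →* B).toMulHom

theorem lift_of (f : X → B) (x : X) : lift k f (of k x) = f x := by
  simp [lift, of]

theorem lift_one (f : X → B) : lift k f 1 = 1 := by
  simp [lift, MonoidAlgebra.one_def]

end FreeUnitalNonassocAlgebra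

namespace MaltsevEnveloping

open FreeUnitalNonassocAlgebra (of)

variable {k L : Type*} [CommRing k] [AddCommGroup L] [Module k L] {b : L →ₗ[k] L →ₗ[k] L}

theorem mk_eq {a c : FreeUnitalNonassocAlgebra k L} (h : Rel b a c) :
    (a : MaltsevEnveloping b) = c :=
  (RingCon.eq _).2 (RingConGen.Rel.of _ _ h)

theorem ι_commutator (x y : L) : ι b x * ι b y - ι b y * ι b x = ι b (b x y) :=
  mk_eq (Rel.commutator x y)

theorem isAlternating_ι (x : L) : IsAlternating (ι b x) where
  left h g := by
    obtain ⟨h, rfl⟩ := RingCon.mk'_surjective _ h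
    obtain ⟨g, rfl⟩ := RingCon.mk'_surjective _ g
    exact mk_eq (Rel.left_alternating x h g)
  right h g := by
    obtain ⟨h, rfl⟩ := RingCon.mk'_surjective _ h
    obtain ⟨g, rfl⟩ := RingCon.mk'_surjective _ g
    exact mk_eq (Rel.right_alternating x h g)

variable (b) in
/-- The canonical map `L → U(L)` as a linear map. -/
noncomputable def ιLinear : L →ₗ[k] MaltsevEnveloping b where
  toFun := ι b
  map_add' x y := mk_eq (Rel.add x y)
  map_smul' c x := mk_eq (Rel.smul c x)

variable (b) in
/-- The quotient map from the free algebra to `U(L)`. -/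
noncomputable def mkHom : FreeUnitalNonassocAlgebra k L →ₙₐ[k] MaltsevEnveloping b :=
  { (ringConGen (Rel b)).mk' with map_smul' := fun _ _ => rfl }

theorem mkHom_surjective : Function.Surjective (mkHom b) :=
  RingCon.mk'_surjective _

variable (b) in
theorem adjoin_insert_one_range_ι :
    NonUnitalAlgebra.adjoin k (insert 1 (Set.range (ι b))) = ⊤ := by
  have h := congrArg (NonUnitalSubalgebra.map (mkHom b))
    (FreeUnitalNonassocAlgebra.adjoin_insert_one_range_of (k := k) (X := L))
  rw [NonUnitalAlgHom.map_adjoin, Set.image_insert_eq, ← Set.range_comp,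
    NonUnitalAlgebra.map_top, (NonUnitalAlgebra.range_eq_top k (mkHom b)).2 mkHom_surjective] at h
  exact h

section Lift

variable {B : Type*} [NonAssocRing B] [Module k B] [IsScalarTower k B B] [SMulCommClass k B B]
  (f : L →ₗ[k] B) (comm : ∀ x y, f x * f y - f y * f x = f (b x y))
  (alt : ∀ x, IsAlternating (f x))

/-- The linear map `U(L) → B` of the universal property of `U(L)`. -/
noncomputable def lift : MaltsevEnveloping b →ₗ[k] B :=
  let F : FreeUnitalNonassocAlgebra k L →+* B :=
    { FreeUnitalNonassocAlgebra.lift k f with map_one' := FreeUnitalNonassocAlgebra.lift_one f }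
  have F_of (x : L) : F (of k x) = f x := FreeUnitalNonassocAlgebra.lift_of f x
  have F_smul (c : k) (u) : F (c • u) = c • F u := (FreeUnitalNonassocAlgebra.lift k f).map_smul c u
  have le_ker : ringConGen (Rel b) ≤ RingCon.ker F := by
    rw [RingCon.ringConGen_le]
    intro u v h
    rw [RingCon.ker_apply]
    cases h with
    | add x y => simp only [map_add, F_of]
    | smul c x => rw [F_of, F_smul, F_of, map_smul]
    | commutator x y => rw [map_sub, map_mul, map_mul, F_of, F_of, F_of, comm]
    | left_alternating x h g =>
      simpa [F_of, associator_apply] using (alt x).left (F h) (F g)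
    | right_alternating x h g =>
      simpa [F_of, associator_apply] using (alt x).right (F h) (F g)
  { RingCon.lift _ F le_ker with
    map_smul' c u := by
      obtain ⟨u, rfl⟩ := RingCon.mk'_surjective _ u
      exact F_smul c u }

theorem isUnitalAlgHom_lift : IsUnitalAlgHom (lift f comm alt) where
  map_one := FreeUnitalNonassocAlgebra.lift_one f
  map_mul := map_mul (RingCon.lift _ _ _)

theorem lift_ι (x : L) : lift f comm alt (ι b x) = f x := FreeUnitalNonassocAlgebra.lift_of f x

end Lift

theorem primitive_mul_sub_primitive_mul {A : Type*} [NonAssocRing A] [Module k A]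
    [IsScalarTower k A A] [SMulCommClass k A A] (x y : A) :
    (x ⊗ₜ[k] (1 : A) + (1 : A) ⊗ₜ[k] x) * (y ⊗ₜ 1 + 1 ⊗ₜ y) -
      (y ⊗ₜ 1 + 1 ⊗ₜ y) * (x ⊗ₜ 1 + 1 ⊗ₜ x) =
        (x * y - y * x) ⊗ₜ 1 + 1 ⊗ₜ (x * y - y * x) := by
  simp only [TensorProduct.sub_tmul, TensorProduct.tmul_sub, add_mul, mul_add,
    Algebra.TensorProduct.tmul_mul_tmul, one_mul, mul_one]
  abel

theorem op_neg_mul_sub_op_neg_mul {A : Type*} [NonAssocRing A] (x y : A) :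
    MulOpposite.op (-x) * MulOpposite.op (-y) - MulOpposite.op (-y) * MulOpposite.op (-x) =
      MulOpposite.op (-(x * y - y * x)) := by
  rw [← MulOpposite.op_mul, ← MulOpposite.op_mul, ← MulOpposite.op_sub, neg_mul_neg, neg_mul_neg,
    neg_sub]

section Structure

variable (b)

/-- The coproduct of `U(L)`. -/
noncomputable def comul : MaltsevEnveloping b →ₗ[k] MaltsevEnveloping b ⊗[k] MaltsevEnveloping b :=
  lift (B := MaltsevEnveloping b ⊗[k] MaltsevEnveloping b)
    ((TensorProduct.mk k (MaltsevEnveloping b) (MaltsevEnveloping b)).flip 1 ∘ₗ ιLinear b +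
      TensorProduct.mk k (MaltsevEnveloping b) (MaltsevEnveloping b) 1 ∘ₗ ιLinear b)
    (fun x y => (primitive_mul_sub_primitive_mul (ι b x) (ι b y)).trans
      (congrArg (fun z => z ⊗ₜ 1 + 1 ⊗ₜ z) (ι_commutator x y)))
    fun x => (isAlternating_ι x).tmul_one.add (isAlternating_ι x).one_tmul

/-- The counit of `U(L)`. -/
noncomputable def counit : MaltsevEnveloping b →ₗ[k] k :=
  lift (B := k) (0 : L →ₗ[k] k) (fun _ _ => sub_self _) fun _ => .of_comm_assoc 0

/-- The antipode of `U(L)`, as a homomorphism into the opposite algebra. -/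
noncomputable def opAntipode : MaltsevEnveloping b →ₗ[k] (MaltsevEnveloping b)ᵐᵒᵖ :=
  lift ((MulOpposite.opLinearEquiv k).toLinearMap ∘ₗ (-ιLinear b))
    (fun x y => (op_neg_mul_sub_op_neg_mul (ι b x) (ι b y)).trans
      (congrArg (fun z => MulOpposite.op (-z)) (ι_commutator x y)))
    fun x => (isAlternating_ι x).neg.op

/-- The antipode of `U(L)`. -/
noncomputable def antipode : MaltsevEnveloping b →ₗ[k] MaltsevEnveloping b :=
  (MulOpposite.opLinearEquiv k).symm.toLinearMap ∘ₗ opAntipode b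

theorem isUnitalAlgHom_comul :
    IsUnitalAlgHom (B := MaltsevEnveloping b ⊗[k] MaltsevEnveloping b) (comul b) :=
  isUnitalAlgHom_lift (B := MaltsevEnveloping b ⊗[k] MaltsevEnveloping b) _ _ _

theorem isUnitalAlgHom_counit : IsUnitalAlgHom (counit b) :=
  isUnitalAlgHom_lift (B := k) _ _ _

theorem isUnitalAlgHom_opAntipode : IsUnitalAlgHom (opAntipode b) :=
  isUnitalAlgHom_lift _ _ _

theorem comul_ι (x : L) : comul b (ι b x) = ι b x ⊗ₜ 1 + 1 ⊗ₜ ι b x :=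
  lift_ι (B := MaltsevEnveloping b ⊗[k] MaltsevEnveloping b) _ _ _ x

theorem counit_ι (x : L) : counit b (ι b x) = 0 :=
  lift_ι (B := k) _ _ _ x

theorem opAntipode_ι (x : L) : opAntipode b (ι b x) = MulOpposite.op (-ι b x) :=
  lift_ι _ _ _ x

theorem antipode_ι (x : L) : antipode b (ι b x) = -ι b x :=
  congrArg MulOpposite.unop (opAntipode_ι b x)

theorem antipode_one : antipode b 1 = 1 :=
  congrArg MulOpposite.unop (isUnitalAlgHom_opAntipode b).map_one

theorem antipode_mul (u v : MaltsevEnveloping b) :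
    antipode b (u * v) = antipode b v * antipode b u :=
  congrArg MulOpposite.unop ((isUnitalAlgHom_opAntipode b).map_mul u v)

/-- The Hopf quasigroup structure on `U(L)` for which the elements of `L` are primitive. -/
noncomputable abbrev hopfQuasigroup : HopfQuasigroup k (MaltsevEnveloping b) :=
  .ofPrimitive (adjoin_insert_one_range_ι b) (Set.forall_mem_range.2 isAlternating_ι)
    (comul b) (isUnitalAlgHom_comul b) (Set.forall_mem_range.2 (comul_ι b))
    (counit b) (isUnitalAlgHom_counit b) (Set.forall_mem_range.2 (counit_ι b))
    (antipode b) (antipode_one b) (antipode_mul b) (Set.forall_mem_range.2 (antipode_ι b))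

end Structure

end MaltsevEnveloping

theorem proposition4p8_general {k L : Type*} [CommRing k] [AddCommGroup L] [Module k L]
    (b : L →ₗ[k] L →ₗ[k] L) :
    ∃! Q : HopfQuasigroup k (MaltsevEnveloping b),
      (∀ x : L, Q.comul (MaltsevEnveloping.ι b x) =
        MaltsevEnveloping.ι b x ⊗ₜ[k] 1 + 1 ⊗ₜ[k] MaltsevEnveloping.ι b x) ∧
      (∀ x : L, Q.counit (MaltsevEnveloping.ι b x) = 0) ∧
      (∀ x : L, Q.antipode (MaltsevEnveloping.ι b x) = -MaltsevEnveloping.ι b x) ∧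
      Q.antipode 1 = 1 ∧
      (∀ u v : MaltsevEnveloping b, Q.antipode (u * v) = Q.antipode v * Q.antipode u) := by
  refine existsUnique_of_exists_of_unique
    ⟨MaltsevEnveloping.hopfQuasigroup b, MaltsevEnveloping.comul_ι b, MaltsevEnveloping.counit_ι b,
      MaltsevEnveloping.antipode_ι b, MaltsevEnveloping.antipode_one b,
      MaltsevEnveloping.antipode_mul b⟩ ?_
  rintro Q R ⟨hQΔ, hQε, hQS, hQ1, hQmul⟩ ⟨hRΔ, hRε, hRS, hR1, hRmul⟩
  exact HopfQuasigroup.ext_of_adjoin_eq_top (MaltsevEnveloping.adjoin_insert_one_range_ι b)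
    (Set.forall_mem_range.2 fun x => (hQΔ x).trans (hRΔ x).symm)
    (Set.forall_mem_range.2 fun x => (hQε x).trans (hRε x).symm)
    (Set.forall_mem_range.2 fun x => (hQS x).trans (hRS x).symm) hQ1 hQmul hR1 hRmul

theorem proposition4p8 {k L : Type*} [Field k] [AddCommGroup L] [Module k L]
    (h2 : ringChar k ≠ 2) (h3 : ringChar k ≠ 3)
    (b : L →ₗ[k] L →ₗ[k] L) (hb : IsMaltsevBracket b) :
    ∃! Q : HopfQuasigroup k (MaltsevEnveloping b),
      (∀ x : L, Q.comul (MaltsevEnveloping.ι b x) =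
        MaltsevEnveloping.ι b x ⊗ₜ[k] 1 + 1 ⊗ₜ[k] MaltsevEnveloping.ι b x) ∧
      (∀ x : L, Q.counit (MaltsevEnveloping.ι b x) = 0) ∧
      (∀ x : L, Q.antipode (MaltsevEnveloping.ι b x) = -MaltsevEnveloping.ι b x) ∧
      Q.antipode 1 = 1 ∧
      (∀ u v : MaltsevEnveloping b, Q.antipode (u * v) = Q.antipode v * Q.antipode u) :=
  proposition4p8_general b
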